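/- **Model.** Time is divided into slots $0,1,2,\dots$. In every slot each of $n\ge 2$ devices sharing one channel is idle, listens, or transmits a message from a set $\mathcal M$; listening and transmitting cost one unit of energy each. In the *Sender-CD* model every listener and every transmitter receives the message if exactly one device transmits, and a silence signal otherwise. The *No-CD* model is the same, except that transmitters receive no signal. All devices run the same randomized algorithm without knowing $n$: the state of a device is the list of its past actions and received signals; some states are terminal and carry an output; in every other state the next action is drawn independently from a discrete probability distribution that depends only on the state. A device that has reached a terminal state stays there and does nothing any more. **Problems.** - *Approximate Counting* with factor $\kappa\ge 1$: all devices terminate with the same output $\tilde n\in\mathbb R$, and $n/\kappa\le\tilde n\le\kappa n$. - *Leader Election*: exactly one device outputs "leader", all others output "follower", and all devices terminate after a common slot, in which the leader transmits and all followers listen. - *Contention Resolution*: all devices terminate, and each of them was the only transmitter in some slot. Let $T,E:\mathbb N\to\mathbb N$. An algorithm solves a problem in time $T$ (and with energy $E$) if for every $n\ge 2$, when it runs on $n$ devices, the following holds except with probability at most $1/n$: after $T(n)$ slots all devices have terminated and the problem is solved (and each device has spent at most $E(n)$ units of energy). Failed executions may run forever and use any amount of energy. Write $\log^* x$ for the least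 $k$ such that the $k$-fold iterate of $\log_2$ at $x$ is at most $1$. **Theorem.** Let $P$ be one of these problems, and let the model be Sender-CD or No-CD. 1. (Polynomial time.) There is an absolute constant $c>0$ such that for all $P$, $k$, $C$ there is $N_0$ with the following property. If an algorithm solves $P$ in time $T$ with energy $E$, where $T(n)\le C n^k$ for all $n\ge1$, then for every $N\ge N_0$ there is a network size $2\le n\le N$ with $E(n)\ge c\log^* N$; that is, $\max_{2\le n\le N}E(n)=\Omega(\log^* N)$. 2. (Towers.) For every $\alpha\in\mathbb N$ there is a constant $c>0$ such that for all $P$ and $C$ the same conclusion holds, with some $N_0$, for all algorithms whose time satisfies $T(n)\le C\cdot 2^{2^{\cdot^{\cdot^{2^{n}}}}}$ ($\alpha$ twos) for all $n\ge 1$. 3. (Detailed form.) For every $P$ there is a constant $D$ such that the following holds. Let $T$ be nondecreasing with $T(n)\ge n$ for all $n$, let an algorithm solve $P$ in time $T$, let $d_1\ge D$, and put $d_{i+1}=T\bigl(2^{2^{2^{2^{d_i}}}}\bigr)$ for $i\ge1$. Then for every $i\ge 1$ there is a network size $n$ with $d_i+1\le n\le d_{i+1}$ such that, when the algorithm runs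 on $n$ devices, each device $s$ has the following property with probability at least $1/2$: for every $1\le j\le i$, the device $s$ spends at least one unit of energy during the slots $d_j,\dots,d_{j+1}-1$. -/

import Mathlib

open scoped ENNReal

universe u

noncomputable section

namespace RadioNetwork

/-- What a device may do in one time slot. -/
inductive Action (M : Type u) : Type u
  | idle : Action M
  | listen : Action M
  | transmit (m : M) : Action M

/-- What a device may perceive at the end of a time slot (`nothing`: no signal at all). -/
inductive Signal (M : Type u) : Type u
  | nothing : Signal M
  | silence : Signal M
  | noise : Signal M
  | message (m : M) : Signal M

/-- The four collision-detection models. -/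
inductive CDModel
  | strongCD
  | senderCD
  | receiverCD
  | noCD

variable {M : Type u} {Out : Type} {n : ℕ}

/-- The message sent by an action, if there is one. -/
def Action.sent : Action M → Option M
  | .transmit m => some m
  | _ => none

/-- The action costs one unit of energy, i.e. it is not `idle`. -/
def Action.Costs : Action M → Prop
  | .idle => False
  | _ => True

/-- The true status of the channel in a slot with actions `a`: silence, a message or a collision. -/
def channel (a : Fin n → Action M) : Signal M :=
  match (List.ofFn a).filterMap Action.sent with
  | [] => .silence
  | [m] => .message m
  | _ => .noise

/-- Without collision detection a collision is perceived as silence. -/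
def Signal.blur : Signal M → Signal M
  | .noise => .silence
  | s => s

/-- What a device that performed a given action perceives when the channel status is `s`. -/
def CDModel.perceive : CDModel → Action M → Signal M → Signal M
  | _, .idle, _ => .nothing
  | .strongCD, .listen, s => s
  | .receiverCD, .listen, s => s
  | .senderCD, .listen, s => s.blur
  | .noCD, .listen, s => s.blur
  | .strongCD, .transmit _, s => s
  | .senderCD, .transmit _, s => s.blur
  | .receiverCD, .transmit _, _ => .nothing
  | .noCD, .transmit _, _ => .nothing

/-- The state of a device: the list of its actions and perceived signals, in chronological order.
The entry at position `k` belongs to time slot `k`; slots are numbered from `0`. -/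
abbrev History (M : Type u) : Type u := List (Action M × Signal M)

/-- A randomized algorithm, run by all devices alike: `output h = some o` says that a device
terminates with output `o` on reaching the state `h`; in a non-terminal state `h` the next action
is drawn from `act h`. -/
structure Algorithm (M : Type u) (Out : Type) where
  output : History M → Option Out
  act : History M → PMF (Action M)

/-- The law of a family of independent draws. -/
def independent {α : Type u} : (n : ℕ) → (Fin n → PMF α) → PMF (Fin n → α)
  | 0, _ => PMF.pure Fin.elim0
  | n + 1, p =>
      (p 0).bind fun a =>
        (independent n fun i => p i.succ).map fun f => (Fin.cons a f : Fin (n + 1) → α)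

/-- The law of the action in state `h`; a terminated device does nothing. -/
def Algorithm.action (A : Algorithm M Out) (h : History M) : PMF (Action M) :=
  if (A.output h).isSome then PMF.pure .idle else A.act h

/-- The state after a slot in which the devices perform the actions `a`.
The state of a terminated device no longer changes. -/
def Algorithm.advance (A : Algorithm M Out) (model : CDModel)
    (H : Fin n → History M) (a : Fin n → Action M) (i : Fin n) : History M :=
  if (A.output (H i)).isSome then H i
  else H i ++ [(a i, model.perceive (a i) (channel a))]

/-- The joint law of the states of `n` devices after `t` time slots. -/
def Algorithm.exec (A : Algorithm M Out) (model : CDModel) (n : ℕ) : ℕ → PMF (Fin n → History M)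
  | 0 => PMF.pure fun _ => []
  | t + 1 => (A.exec model n t).bind fun H =>
      (independent n fun i => A.action (H i)).map (A.advance model H)

/-- The probability of an event. -/
def prob {α : Type u} (p : PMF α) (S : Set α) : ℝ≥0∞ := p.toOuterMeasure S

/-- The device with history `h` transmits in slot `k`. -/
def TransmitsAt (h : History M) (k : ℕ) : Prop := ∃ m s, h[k]? = some (.transmit m, s)

/-- The device with history `h` listens in slot `k`. -/
def ListensAt (h : History M) (k : ℕ) : Prop := ∃ s, h[k]? = some (.listen, s)

/-- The device with history `h` spends a unit of energy in slot `k`. -/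
def SpendsAt (h : History M) (k : ℕ) : Prop := ∃ e, h[k]? = some e ∧ e.1.Costs

open Classical in
/-- The total energy spent in a history. -/
def energy (h : History M) : ℕ := h.countP fun e => decide e.1.Costs

/-- Outputs in leader election. -/
inductive Role
  | leader
  | follower

/-- The problems considered; `κ` is the approximation factor of approximate counting. -/
inductive Problem
  | approximateCounting (κ : ℝ) (hκ : 1 ≤ κ)
  | leaderElection
  | contentionResolution

/-- The outputs of a problem. -/
def Problem.Output : Problem → Type
  | .approximateCounting _ _ => ℝ
  | .leaderElection => Role
  | .contentionResolution => Unit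

/-- `P.Solved out H`: all `n` devices have terminated, with histories `H` and outputs `out`,
and have solved the problem.
* Approximate counting: all devices agree on an estimate within a factor `κ` of `n`.
* Leader election: one device is the leader and all others are followers; in the last slot
  the leader transmits and every follower listens.
* Contention resolution: every device has been the only transmitter in some slot. -/
def Problem.Solved {n : ℕ} : (P : Problem) → (Fin n → Option P.Output) → (Fin n → History M) → Prop
  | .approximateCounting κ _, out, _ =>
      ∃ est : ℝ, (n : ℝ) / κ ≤ est ∧ est ≤ κ * n ∧ ∀ i, out i = some est
  | .leaderElection, out, H =>
      ∃ ℓ : Fin n, out ℓ = some Role.leader ∧ (∀ i, i ≠ ℓ → out i = some Role.follower) ∧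
        ∃ k, (∀ i, (H i).length = k + 1) ∧ TransmitsAt (H ℓ) k ∧ ∀ i, i ≠ ℓ → ListensAt (H i) k
  | .contentionResolution, out, H =>
      ∀ i, out i = some () ∧ ∃ k, TransmitsAt (H i) k ∧ ∀ j, j ≠ i → ¬ TransmitsAt (H j) k

/-- The profile of states `H` solves the problem `P` that `A` is designed for. -/
def Algorithm.Success {P : Problem} (A : Algorithm M P.Output) (H : Fin n → History M) : Prop :=
  P.Solved (fun i => A.output (H i)) H

/-- On any `n ≥ 2` devices, `A` solves `P` within `T n` slots, except with probability at most
`1 / n`. -/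
def Algorithm.SolvesInTime {P : Problem} (A : Algorithm M P.Output) (model : CDModel)
    (T : ℕ → ℕ) : Prop :=
  ∀ n : ℕ, 2 ≤ n → prob (A.exec model n (T n)) {H | ¬ A.Success H} ≤ 1 / (n : ℝ≥0∞)

/-- On any `n ≥ 2` devices, `A` solves `P` within `T n` slots and with at most `E n` units of energy
per device, except with probability at most `1 / n`. A failed execution may go on forever and use
any amount of energy. -/
def Algorithm.SolvesInTimeEnergy {P : Problem} (A : Algorithm M P.Output) (model : CDModel)
    (T E : ℕ → ℕ) : Prop :=
  ∀ n : ℕ, 2 ≤ n →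
    prob (A.exec model n (T n)) {H | ¬ (A.Success H ∧ ∀ i, energy (H i) ≤ E n)} ≤ 1 / (n : ℝ≥0∞)

/-- The tower of `α` twos with `x` on top. -/
def tower (α x : ℕ) : ℕ := (fun y => 2 ^ y)^[α] x

/-- The iterated logarithm: how often `log₂` has to be applied to get from `x` to at most `1`. -/
def logStar (x : ℝ) : ℕ := sInf {k : ℕ | (Real.logb 2)^[k] x ≤ 1}

/-- The checkpoints (numbered from `0`) for the time bound `T`, with first checkpoint `d₁`. -/
def checkpoint (T : ℕ → ℕ) (d₁ : ℕ) : ℕ → ℕ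
  | 0 => d₁
  | i + 1 => T (2 ^ 2 ^ 2 ^ 2 ^ checkpoint T d₁ i)

/-- Energy lower bound `Ω(log* n)` with constant `c`, in Sender-CD and in No-CD, for all algorithms
for `P` with running time at most `F n`: if `E n` bounds the energy, then the maximum of `E n`
over all network sizes `n ≤ N` is at least `c * log* N`, as soon as `N` is large. -/
def LogStarEnergyBound (c : ℝ) (P : Problem) (F : ℕ → ℕ) : Prop :=
  ∃ N₀ : ℕ, ∀ (M : Type u) (model : CDModel), (model = .senderCD ∨ model = .noCD) →
    ∀ (A : Algorithm M P.Output) (T E : ℕ → ℕ), (∀ n, 1 ≤ n → T n ≤ F n) →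
      A.SolvesInTimeEnergy model T E →
        ∀ N : ℕ, N₀ ≤ N → ∃ n, 2 ≤ n ∧ n ≤ N ∧ c * (logStar N : ℝ) ≤ (E n : ℝ)

end RadioNetwork

end

open RadioNetwork

/-! In Sender-CD and No-CD a device perceives nothing unusual in a slot unless exactly one device
transmits. As long as no such slot has occurred (`Quiet`), the devices therefore evolve as
independent copies of one lone device that hears only silence (`Algorithm.solo`); this is
`expect_run_quiet`. If moreover a device stays idle from slot `d` on, it learns nothing afterwards
whatever the others do, so its own state still follows the lone law (`expect_run_rests`).

Quiet starts are common. If a lone device transmits in a given slot with probability `p`, then the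
chance `n p (1-p)^(n-1)` of a single transmitter, summed over all powers of two `n`, is bounded by a
constant. Averaging over `2 d²` scales gives a size `n = 2^k` whose first `d` slots are quiet except
with probability `1/d` (`exists_quiet_size`).

Consequently a lone device rarely rests between consecutive checkpoints (`exists_solo_rests_le`).
For leader election and contention resolution, success after a quiet start forces every device to
spend energy later. For approximate counting, a resting device cannot distinguish two quiet sizes
whose admissible estimates are disjoint.

For a network size with the first `d_i` slots quiet, a union bound over the intervals up to
`d_{i+1}` shows that a device is likely to pay in every one of them (`exists_size_spending`). If the
time is a tower of height `α`, each checkpoint adds at most `α + 5` exponentials, so about `log* N /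
(α + 5)` checkpoints fit below `N` (`logStarEnergyBound_tower`). -/

namespace RadioNetwork

/-! ### Expectations under discrete laws and independent draws. -/

/-- The expectation of an extended nonnegative function. -/
noncomputable def expect {α : Type*} (p : PMF α) (f : α → ℝ≥0∞) : ℝ≥0∞ :=
  tsum fun x => p x * f x

/-- The indicator of a proposition. -/
noncomputable def ind (q : Prop) : ℝ≥0∞ := open Classical in if q then 1 else 0

section Ind

variable {q r : Prop}

theorem ind_of_true (h : q) : ind q = 1 := if_pos h

theorem ind_of_false (h : ¬ q) : ind q = 0 := if_neg h

theorem ind_mono (h : q → r) : ind q ≤ ind r := by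
  by_cases hq : q
  · rw [ind_of_true hq, ind_of_true (h hq)]
  · rw [ind_of_false hq]; exact zero_le

theorem ind_congr (h : q ↔ r) : ind q = ind r := by rw [propext h]

theorem ind_and : ind (q ∧ r) = ind q * ind r := by
  by_cases hq : q <;> by_cases hr : r <;> simp [ind, hq, hr]

theorem ind_add_ind_not : ind q + ind (¬ q) = 1 := by
  by_cases hq : q <;> simp [ind, hq]

theorem ind_or_le : ind (q ∨ r) ≤ ind q + ind r := by
  by_cases hq : q <;> by_cases hr : r <;> simp [ind, hq, hr]

theorem ind_exists_le {ι : Type*} (s : Finset ι) (q : ι → Prop) :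
    ind (∃ i ∈ s, q i) ≤ ∑ i ∈ s, ind (q i) := by
  by_cases h : ∃ i ∈ s, q i
  · obtain ⟨i, hi, hq⟩ := h
    calc ind (∃ i ∈ s, q i) = ind (q i) := by rw [ind_of_true ⟨i, hi, hq⟩, ind_of_true hq]
      _ ≤ ∑ i ∈ s, ind (q i) := Finset.single_le_sum (f := fun i => ind (q i))
          (fun _ _ => zero_le) hi
  · rw [ind_of_false h]; exact zero_le

end Ind

section Expect

variable {α β : Type*}

theorem expect_congr {p : PMF α} {f g : α → ℝ≥0∞} (h : ∀ x ∈ p.support, f x = g x) :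
    expect p f = expect p g := by
  refine tsum_congr fun x => ?_
  by_cases hx : x ∈ p.support
  · rw [h x hx]
  · rw [PMF.apply_eq_zero_iff _ _ |>.2 hx, zero_mul, zero_mul]

theorem expect_le_expect {p : PMF α} {f g : α → ℝ≥0∞} (h : ∀ x ∈ p.support, f x ≤ g x) :
    expect p f ≤ expect p g := by
  refine ENNReal.tsum_le_tsum fun x => ?_
  by_cases hx : x ∈ p.support
  · gcongr; exact h x hx
  · rw [PMF.apply_eq_zero_iff _ _ |>.2 hx, zero_mul, zero_mul]

theorem expect_mono {p : PMF α} {f g : α → ℝ≥0∞} (h : ∀ x, f x ≤ g x) :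
    expect p f ≤ expect p g := expect_le_expect fun x _ => h x

theorem expect_pure (x : α) (f : α → ℝ≥0∞) : expect (PMF.pure x) f = f x := by
  classical
  rw [expect, tsum_eq_single x]
  · simp
  · intro y hy; simp [PMF.pure_apply, hy]

theorem expect_bind (p : PMF α) (q : α → PMF β) (f : β → ℝ≥0∞) :
    expect (p.bind q) f = expect p fun x => expect (q x) f := by
  simp only [expect, PMF.bind_apply, ← ENNReal.tsum_mul_right, ← ENNReal.tsum_mul_left]
  rw [ENNReal.tsum_comm]
  simp only [mul_assoc]

theorem expect_map (p : PMF α) (g : α → β) (f : β → ℝ≥0∞) :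
    expect (p.map g) f = expect p fun x => f (g x) := by
  rw [← PMF.bind_pure_comp, expect_bind]
  simp only [Function.comp, expect_pure]

theorem expect_const (p : PMF α) (c : ℝ≥0∞) : expect p (fun _ => c) = c := by
  rw [expect, ENNReal.tsum_mul_right, p.tsum_coe, one_mul]

theorem expect_add (p : PMF α) (f g : α → ℝ≥0∞) :
    expect p (fun x => f x + g x) = expect p f + expect p g := by
  simp only [expect, mul_add, ENNReal.tsum_add]

theorem expect_mul_const (p : PMF α) (f : α → ℝ≥0∞) (c : ℝ≥0∞) :
    expect p (fun x => f x * c) = expect p f * c := by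
  simp only [expect, ← mul_assoc, ENNReal.tsum_mul_right]

theorem expect_const_mul (p : PMF α) (f : α → ℝ≥0∞) (c : ℝ≥0∞) :
    expect p (fun x => c * f x) = c * expect p f := by
  simp only [mul_comm c, expect_mul_const]

theorem expect_sum {ι : Type*} (p : PMF α) (s : Finset ι) (f : ι → α → ℝ≥0∞) :
    expect p (fun x => ∑ i ∈ s, f i x) = ∑ i ∈ s, expect p (f i) := by
  classical
  induction s using Finset.induction_on with
  | empty => simpa using expect_const p 0
  | insert i s hi ih => simp only [Finset.sum_insert hi, expect_add, ih]

theorem expect_ind_add_expect_ind_not (p : PMF α) (q : α → Prop) :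
    expect p (fun x => ind (q x)) + expect p (fun x => ind (¬ q x)) = 1 := by
  rw [← expect_add]
  simp only [ind_add_ind_not, expect_const]

theorem expect_ind_le_one (p : PMF α) (q : α → Prop) : expect p (fun x => ind (q x)) ≤ 1 := by
  rw [← expect_ind_add_expect_ind_not p q]; exact le_self_add

theorem expect_ind_ne_top (p : PMF α) (q : α → Prop) : expect p (fun x => ind (q x)) ≠ ∞ :=
  ne_top_of_le_ne_top ENNReal.one_ne_top (expect_ind_le_one p q)

theorem expect_ind_not (p : PMF α) (q : α → Prop) :
    expect p (fun x => ind (¬ q x)) = 1 - expect p (fun x => ind (q x)) := by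
  rw [← expect_ind_add_expect_ind_not p q, ENNReal.add_sub_cancel_left (expect_ind_ne_top p q)]

theorem expect_ind_le_add_not (p : PMF α) (q r : α → Prop) :
    expect p (fun x => ind (q x)) ≤
      expect p (fun x => ind (q x ∧ r x)) + expect p (fun x => ind (¬ r x)) := by
  rw [← expect_add]
  refine expect_mono fun x => le_trans (ind_mono fun hq => ?_) ind_or_le
  by_cases hr : r x
  · exact Or.inl ⟨hq, hr⟩
  · exact Or.inr hr

theorem prob_eq_expect {α : Type u} (p : PMF α) (S : Set α) :
    prob p S = expect p fun x => ind (x ∈ S) := by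
  classical
  rw [prob, PMF.toOuterMeasure_apply, expect]
  refine tsum_congr fun x => ?_
  by_cases hx : x ∈ S <;> simp [ind, hx]

theorem expect_independent_prod {α : Type u} {n : ℕ} (p : Fin n → PMF α)
    (f : Fin n → α → ℝ≥0∞) :
    expect (independent n p) (fun x => ∏ i, f i (x i)) = ∏ i, expect (p i) (f i) := by
  induction n with
  | zero => simp [independent, expect_pure]
  | succ n ih =>
    rw [independent, expect_bind, Fin.prod_univ_succ]
    simp only [expect_map, Fin.prod_univ_succ, Fin.cons_zero, Fin.cons_succ, expect_const_mul]
    simp only [ih (fun i => p i.succ) (fun i => f i.succ), expect_mul_const]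

theorem expect_independent_apply {α : Type u} {n : ℕ} (p : Fin n → PMF α) (s : Fin n)
    (f : α → ℝ≥0∞) :
    expect (independent n p) (fun x => f (x s)) = expect (p s) f := by
  classical
  have h := expect_independent_prod p fun i => if i = s then f else fun _ => 1
  have h₁ : ∀ x : Fin n → α, ∏ i, (if i = s then f else fun _ => 1) (x i) = f (x s) := by
    intro x
    rw [Finset.prod_eq_single s] <;> simp +contextual
  have h₂ : ∏ i, expect (p i) (if i = s then f else fun _ => 1) = expect (p s) f := by
    rw [Finset.prod_eq_single s]
    · simp
    · intro i _ hi; simpa [hi] using expect_const (p i) 1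
    · simp
  rw [← h₂, ← h]
  simp only [h₁]

theorem mem_support_apply_of_mem_support_independent {α : Type u} {n : ℕ} {p : Fin n → PMF α}
    {x : Fin n → α} (hx : x ∈ (independent n p).support) (i : Fin n) : x i ∈ (p i).support := by
  by_contra hi
  have h : expect (independent n p) (fun x => ind (x i ∉ (p i).support)) = 0 := by
    rw [expect_independent_apply p i fun y => ind (y ∉ (p i).support),
      expect_congr (g := fun _ => 0) fun y hy => ind_of_false (not_not.2 hy), expect_const]
  rw [expect, ENNReal.tsum_eq_zero] at h
  have := h x
  rw [ind_of_true hi, mul_one] at this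
  exact hx this

end Expect

/-! ### Executions, lone devices, and the comparison between them. -/

section

variable {M : Type u} {Out : Type} {n : ℕ}

/-- The state of a device after an action `a` in a slot with channel status `s`. -/
def Algorithm.step (A : Algorithm M Out) (model : CDModel) (s : Signal M) (h : History M)
    (a : Action M) : History M :=
  if (A.output h).isSome then h else h ++ [(a, model.perceive a s)]

/-- The joint law of the states when the channel status is computed by the rule `c`. -/
noncomputable def Algorithm.run (A : Algorithm M Out) (model : CDModel)
    (c : (Fin n → Action M) → Signal M) : ℕ → PMF (Fin n → History M)
  | 0 => PMF.pure fun _ => []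
  | t + 1 => (A.run model c t).bind fun H =>
      (independent n fun i => A.action (H i)).map fun a i => A.step model (c a) (H i) (a i)

/-- The law of the state of a device which never receives a message. -/
noncomputable def Algorithm.solo (A : Algorithm M Out) (model : CDModel) : ℕ → PMF (History M)
  | 0 => PMF.pure []
  | t + 1 => (A.solo model t).bind fun h => (A.action h).map (A.step model .silence h)

/-- The rule by which the channel is always silent. -/
def mute (_ : Fin n → Action M) : Signal M := .silence

variable {A : Algorithm M Out} {model : CDModel} {c : (Fin n → Action M) → Signal M}

theorem Algorithm.exec_eq_run (A : Algorithm M Out) (model : CDModel) (n t : ℕ) :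
    A.exec model n t = A.run model channel t := by
  induction t with
  | zero => rfl
  | succ t ih => rw [Algorithm.exec, Algorithm.run, ih]; rfl

theorem expect_run_succ (t : ℕ) (f : (Fin n → History M) → ℝ≥0∞) :
    expect (A.run model c (t + 1)) f = expect (A.run model c t) fun H =>
      expect (independent n fun i => A.action (H i)) fun a =>
        f fun i => A.step model (c a) (H i) (a i) := by
  simp only [Algorithm.run, expect_bind, expect_map]

theorem expect_solo_succ (t : ℕ) (f : History M → ℝ≥0∞) :
    expect (A.solo model (t + 1)) f = expect (A.solo model t) fun h =>
      expect (A.action h) fun a => f (A.step model .silence h a) := by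
  simp only [Algorithm.solo, expect_bind, expect_map]

/-- The devices interact only through the channel, so with constant channel status the joint law
remains a product. -/
theorem expect_run_mute_prod (t : ℕ) (f : Fin n → History M → ℝ≥0∞) :
    expect (A.run model mute t) (fun H => ∏ i, f i (H i)) =
      ∏ i, expect (A.solo model t) (f i) := by
  induction t generalizing f with
  | zero => simp [Algorithm.run, Algorithm.solo, expect_pure]
  | succ t ih =>
    rw [expect_run_succ]
    simp only [expect_solo_succ]
    rw [← ih]
    refine expect_congr fun H _ => ?_
    exact expect_independent_prod (fun i => A.action (H i))
      fun i a => f i (A.step model .silence (H i) a)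

theorem expect_run_mute_apply (t : ℕ) (s : Fin n) (f : History M → ℝ≥0∞) :
    expect (A.run model mute t) (fun H => f (H s)) = expect (A.solo model t) f := by
  induction t generalizing f with
  | zero => simp [Algorithm.run, Algorithm.solo, expect_pure]
  | succ t ih =>
    rw [expect_run_succ, expect_solo_succ, ← ih]
    refine expect_congr fun H _ => ?_
    exact expect_independent_apply (fun i => A.action (H i)) s
      fun a => f (A.step model .silence (H s) a)

/-- The length of a state that may occur after `t` slots. -/
def Aligned (A : Algorithm M Out) (t : ℕ) (h : History M) : Prop :=
  h.length ≤ t ∧ ((A.output h).isSome = false → h.length = t)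

theorem Aligned.step {t : ℕ} {h : History M} (hh : Aligned A t h) (s : Signal M) (a : Action M) :
    Aligned A (t + 1) (A.step model s h a) := by
  unfold Algorithm.step
  split_ifs with ho
  · exact ⟨hh.1.trans t.le_succ, fun h' => by simp [ho] at h'⟩
  · have := hh.2 (by simpa using ho)
    simp [Aligned, this]

theorem aligned_of_mem_support {t : ℕ} {H : Fin n → History M}
    (hH : H ∈ (A.run model c t).support) (i : Fin n) : Aligned A t (H i) := by
  induction t generalizing H with
  | zero =>
    rw [Algorithm.run, PMF.mem_support_pure_iff] at hH
    subst hH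
    simp [Aligned]
  | succ t ih =>
    simp only [Algorithm.run, PMF.mem_support_bind_iff, PMF.mem_support_map_iff] at hH
    obtain ⟨H', hH', a, -, rfl⟩ := hH
    exact (ih hH').step _ _

theorem step_take {d t : ℕ} {h : History M} (hh : Aligned A t h) (hd : d ≤ t) (s : Signal M)
    (a : Action M) : (A.step model s h a).take d = h.take d := by
  unfold Algorithm.step
  split_ifs with ho
  · rfl
  · have := hh.2 (by simpa using ho)
    exact List.take_append_of_le_length (by omega)

/-- What happens before slot `d` is decided at time `d`. -/
theorem expect_run_take {d t : ℕ} (hd : d ≤ t) (f : (Fin n → History M) → ℝ≥0∞) :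
    expect (A.run model c t) (fun H => f fun i => (H i).take d) = expect (A.run model c d) f := by
  induction t, hd using Nat.le_induction with
  | base =>
    refine expect_congr fun H hH => ?_
    congr 1
    ext1 i
    exact List.take_of_length_le (aligned_of_mem_support hH i).1
  | succ t hd ih =>
    rw [expect_run_succ, ← ih]
    refine expect_congr fun H hH => ?_
    simp only [step_take (aligned_of_mem_support hH _) hd, expect_const]

/-- An event that cannot be undone becomes more likely with time. -/
theorem expect_run_mono {S : (Fin n → History M) → Prop}
    (hS : ∀ H s (a : Fin n → Action M), S H → S fun i => A.step model s (H i) (a i))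
    {t t' : ℕ} (ht : t ≤ t') :
    expect (A.run model c t) (fun H => ind (S H)) ≤
      expect (A.run model c t') (fun H => ind (S H)) := by
  induction t', ht using Nat.le_induction with
  | base => exact le_rfl
  | succ t' _ ih =>
    refine ih.trans ?_
    rw [expect_run_succ]
    refine expect_mono fun H => ?_
    rw [← expect_const (independent n fun i => A.action (H i)) (ind (S H))]
    exact expect_mono fun a => ind_mono (hS H _ a)

theorem transmitsAt_take {h : History M} {d k : ℕ} (hk : k < d) :
    TransmitsAt (h.take d) k ↔ TransmitsAt h k := by
  simp [TransmitsAt, hk]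

theorem spendsAt_take {h : History M} {d k : ℕ} (hk : k < d) :
    SpendsAt (h.take d) k ↔ SpendsAt h k := by
  simp [SpendsAt, hk]

/-- Exactly one device transmits in slot `k`. -/
def SingleAt (H : Fin n → History M) (k : ℕ) : Prop :=
  ∃ i, TransmitsAt (H i) k ∧ ∀ j, j ≠ i → ¬ TransmitsAt (H j) k

/-- Nobody is the only transmitter in any slot before slot `d`. -/
def Quiet (d : ℕ) (H : Fin n → History M) : Prop := ∀ k < d, ¬ SingleAt H k

/-- The device spends no energy from slot `d` until before slot `t`. -/
def Rests (d t : ℕ) (h : History M) : Prop := ∀ k, d ≤ k → k < t → ¬ SpendsAt h k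

theorem quiet_take {d : ℕ} (H : Fin n → History M) :
    Quiet d (fun i => (H i).take d) ↔ Quiet d H := by
  refine forall₂_congr fun k hk => ?_
  simp only [SingleAt, transmitsAt_take hk]

theorem rests_take {d t : ℕ} (h : History M) : Rests d t (h.take t) ↔ Rests d t h := by
  refine forall_congr' fun k => forall₂_congr fun _ hk => ?_
  rw [spendsAt_take hk]

theorem rests_take_of_le {d t t' : ℕ} (ht : t ≤ t') (h : History M) :
    Rests d t (h.take t') ↔ Rests d t h := by
  refine forall_congr' fun k => forall₂_congr fun _ hk => ?_
  rw [spendsAt_take (hk.trans_le ht)]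

theorem quiet_step {d t : ℕ} {H : Fin n → History M} (hH : ∀ i, Aligned A t (H i)) (hd : d ≤ t)
    (s : Signal M) (a : Fin n → Action M) :
    Quiet d (fun i => A.step model s (H i) (a i)) ↔ Quiet d H := by
  rw [← quiet_take, ← quiet_take H]
  simp only [step_take (hH _) hd]

theorem rests_step {d t : ℕ} {h : History M} (hh : Aligned A t h) (s : Signal M)
    (a : Action M) : Rests d t (A.step model s h a) ↔ Rests d t h := by
  rw [← rests_take, ← rests_take h, step_take hh le_rfl]

theorem step_getElem? {t : ℕ} {h : History M} (hh : Aligned A t h) (s : Signal M)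
    (a : Action M) : (A.step model s h a)[t]? =
      if (A.output h).isSome then none else some (a, model.perceive a s) := by
  unfold Algorithm.step
  split_ifs with ho
  · simpa using hh.1
  · have := hh.2 (by simpa using ho)
    subst this
    simp

theorem eq_idle_of_mem_support_action {h : History M} {a : Action M}
    (ha : a ∈ (A.action h).support) (ho : (A.output h).isSome) : a = .idle := by
  rwa [Algorithm.action, if_pos ho, PMF.mem_support_pure_iff] at ha

theorem transmitsAt_step {t : ℕ} {h : History M} (hh : Aligned A t h) (s : Signal M)
    {a : Action M} (ha : a ∈ (A.action h).support) :
    TransmitsAt (A.step model s h a) t ↔ a.sent.isSome := by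
  rw [TransmitsAt, step_getElem? hh]
  split_ifs with ho
  · simp [eq_idle_of_mem_support_action ha ho, Action.sent]
  · cases a <;> simp [Action.sent]

theorem spendsAt_step {t : ℕ} {h : History M} (hh : Aligned A t h) (s : Signal M)
    {a : Action M} (ha : a ∈ (A.action h).support) :
    SpendsAt (A.step model s h a) t ↔ a ≠ .idle := by
  rw [SpendsAt, step_getElem? hh]
  split_ifs with ho
  · simp [eq_idle_of_mem_support_action ha ho]
  · cases a <;> simp [Action.Costs]

/-- If not exactly one device transmits, then the channel carries no message. -/
theorem blur_channel {a : Fin n → Action M}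
    (ha : ¬ ∃ i, (a i).sent.isSome ∧ ∀ j, j ≠ i → ¬ (a j).sent.isSome) :
    (channel a).blur = .silence := by
  unfold channel
  split
  · rfl
  · rename_i m hm
    refine absurd ?_ ha
    rw [List.filterMap_eq_cons_iff] at hm
    obtain ⟨l₁, x, l₂, hl, h₁, hx, h₂⟩ := hm
    rw [List.filterMap_eq_nil_iff] at h₂
    have hlen : n = l₁.length + (l₂.length + 1) := by
      simpa using congrArg List.length hl
    have hget : ∀ j : Fin n, (l₁ ++ x :: l₂)[(j : ℕ)]? = some (a j) := by
      intro j
      rw [← hl]; simp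
    refine ⟨⟨l₁.length, by omega⟩, ?_, fun j hj => ?_⟩
    · have := hget ⟨l₁.length, by omega⟩
      simp only [List.getElem?_append_right le_rfl, Nat.sub_self, List.getElem?_cons_zero,
        Option.some.injEq] at this
      rw [← this, hx]; rfl
    · have hj' : (j : ℕ) ≠ l₁.length := fun h => hj (Fin.ext h)
      have := hget j
      rcases lt_or_gt_of_ne hj' with h | h
      · rw [List.getElem?_append_left h] at this
        rw [h₁ _ (List.mem_of_getElem? this)]; simp
      · rw [List.getElem?_append_right h.le, show (j : ℕ) - l₁.length = (j - l₁.length - 1) + 1 by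
          omega, List.getElem?_cons_succ] at this
        rw [h₂ _ (List.mem_of_getElem? this)]; simp
  · rfl

theorem perceive_of_blur (hm : model = .senderCD ∨ model = .noCD) {s : Signal M}
    (hs : s.blur = .silence) (a : Action M) :
    model.perceive a s = model.perceive a .silence := by
  rcases hm with rfl | rfl <;> cases a <;> simp only [CDModel.perceive, hs] <;> rfl

/-- On quiet executions, devices behave as if they were alone. -/
theorem expect_run_quiet (hm : model = .senderCD ∨ model = .noCD) (t : ℕ)
    (f : (Fin n → History M) → ℝ≥0∞) :
    expect (A.run model channel t) (fun H => f H * ind (Quiet t H)) =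
      expect (A.run model mute t) (fun H => f H * ind (Quiet t H)) := by
  induction t generalizing f with
  | zero => simp [Algorithm.run, expect_pure]
  | succ t ih =>
    let single (a : Fin n → Action M) : Prop :=
      ∃ i, (a i).sent.isSome ∧ ∀ j, j ≠ i → ¬ (a j).sent.isSome
    -- The right-hand side depends on the rule `c` only through the first `t` slots, so one
    -- recursion serves both `channel` and `mute`.
    have key : ∀ c : (Fin n → Action M) → Signal M, (∀ a, ¬ single a → (c a).blur = .silence) →
        expect (A.run model c (t + 1)) (fun H => f H * ind (Quiet (t + 1) H)) =
        expect (A.run model c t) (fun H =>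
          (expect (independent n fun i => A.action (H i)) fun a =>
            f (fun i => A.step model .silence (H i) (a i)) * ind (¬ single a)) *
          ind (Quiet t H)) := by
      intro c hc
      rw [expect_run_succ]
      refine expect_congr fun H hH => ?_
      have hH := aligned_of_mem_support hH
      rw [← expect_mul_const]
      refine expect_congr fun a ha => ?_
      have ha := mem_support_apply_of_mem_support_independent ha
      have hq : Quiet (t + 1) (fun i => A.step model (c a) (H i) (a i)) ↔
          ¬ single a ∧ Quiet t H := by
        rw [← quiet_step hH le_rfl (c a) a, and_comm]
        simp only [Quiet, Nat.lt_succ_iff_lt_or_eq, or_imp, forall_and, forall_eq]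
        refine and_congr_right fun _ => not_congr ?_
        simp only [SingleAt, transmitsAt_step (hH _) _ (ha _), single]
      rw [ind_congr hq, ind_and, ← mul_assoc]
      congr 1
      by_cases hs : single a
      · rw [ind_of_false (not_not.2 hs), mul_zero, mul_zero]
      · simp only [Algorithm.step, perceive_of_blur hm (hc a hs)]
    rw [key channel fun a ha => blur_channel ha, key mute fun a _ => rfl, ih]

/-- Of a device which rests after a quiet start one cannot tell that it is not alone. -/
theorem expect_run_rests (hm : model = .senderCD ∨ model = .noCD) {d t : ℕ} (ht : d ≤ t)
    (s : Fin n) (w : History M → ℝ≥0∞) :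
    expect (A.run model channel t) (fun H => w (H s) * ind (Rests d t (H s)) * ind (Quiet d H)) =
      expect (A.run model mute t)
        (fun H => w (H s) * ind (Rests d t (H s)) * ind (Quiet d H)) := by
  induction t, ht using Nat.le_induction generalizing w with
  | base => exact expect_run_quiet hm d fun H => w (H s) * ind (Rests d d (H s))
  | succ t hd ih =>
    have key : ∀ c : (Fin n → Action M) → Signal M,
        expect (A.run model c (t + 1))
          (fun H => w (H s) * ind (Rests d (t + 1) (H s)) * ind (Quiet d H)) =
        expect (A.run model c t) (fun H =>
          (expect (A.action (H s)) fun a => w (A.step model .silence (H s) a) * ind (a = .idle)) *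
          ind (Rests d t (H s)) * ind (Quiet d H)) := by
      intro c
      rw [expect_run_succ]
      refine expect_congr fun H hH => ?_
      have hH := aligned_of_mem_support hH
      rw [← expect_independent_apply (fun i => A.action (H i)) s
        fun a => w (A.step model .silence (H s) a) * ind (a = .idle), ← expect_mul_const,
        ← expect_mul_const]
      refine expect_congr fun a ha => ?_
      have ha := mem_support_apply_of_mem_support_independent ha
      have hr : Rests d (t + 1) (A.step model (c a) (H s) (a s)) ↔
          a s = .idle ∧ Rests d t (H s) := by
        rw [← rests_step (hH s) (c a) (a s), and_comm, ← not_ne_iff (a := a s),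
          ← spendsAt_step (hH s) (c a) (ha s)]
        simp only [Rests, Nat.lt_succ_iff_lt_or_eq, or_imp, forall_and]
        refine and_congr_right fun _ => ?_
        exact ⟨fun h => h t hd rfl, fun h k _ hk => hk ▸ h⟩
      rw [ind_congr (quiet_step hH hd (c a) a), ind_congr hr, ind_and, ← mul_assoc]
      congr 2
      -- An idle device perceives `nothing` for every channel status, so the rule `c` drops out.
      by_cases hs : a s = .idle
      · simp only [hs, Algorithm.step, CDModel.perceive]
      · rw [ind_of_false hs, mul_zero, mul_zero]
    rw [key, key]
    exact ih fun h => expect (A.action h) fun a => w (A.step model .silence h a) * ind (a = .idle)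

end

/-! ### Network sizes with a quiet start. -/

section

variable {M : Type u} {Out : Type} {n : ℕ} {A : Algorithm M Out} {model : CDModel}

/-- In `a` independent trials of success probability `1 - q`, exactly one success is no likelier
than at least one. -/
theorem mul_pow_le_one_sub_pow {q : ℝ} (h₀ : 0 ≤ q) (h₁ : q ≤ 1) (a : ℕ) :
    a * (1 - q) * q ^ (a - 1) ≤ 1 - q ^ a := by
  have hg : (∑ j ∈ Finset.range a, q ^ j) * (1 - q) = 1 - q ^ a := geom_sum_mul_neg q a
  have hs : a * q ^ (a - 1) ≤ ∑ j ∈ Finset.range a, q ^ j := by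
    have : ∑ j ∈ Finset.range a, q ^ (a - 1) ≤ ∑ j ∈ Finset.range a, q ^ j :=
      Finset.sum_le_sum fun j hj =>
        pow_le_pow_of_le_one h₀ h₁ (by have := Finset.mem_range.1 hj; omega)
    simpa using this
  nlinarith [mul_le_mul_of_nonneg_right hs (sub_nonneg.2 h₁)]

/-- For a device transmitting with probability `p`, there are few scales `k` at which `2 ^ k` such
devices are likely to have a single transmitter. -/
theorem sum_two_pow_mul_le {p : ℝ} (h₀ : 0 ≤ p) (h₁ : p ≤ 1) (a K : ℕ) :
    ∑ k ∈ Finset.range K, (2 : ℝ) ^ (a + k + 1) * (p * (1 - p) ^ (2 ^ (a + k + 1) - 1)) ≤ 2 := by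
  have hq₀ : 0 ≤ 1 - p := sub_nonneg.2 h₁
  have hq₁ : 1 - p ≤ 1 := by linarith
  -- Multiplying the preceding lemma for `2 ^ (a + k)` trials by `(1 - p) ^ 2 ^ (a + k)` makes the
  -- sum over `k` telescope.
  have key : ∀ k, (2 : ℝ) ^ (a + k + 1) * (p * (1 - p) ^ (2 ^ (a + k + 1) - 1)) ≤
      2 * ((1 - p) ^ 2 ^ (a + k) - (1 - p) ^ 2 ^ (a + (k + 1))) := by
    intro k
    have h := mul_pow_le_one_sub_pow hq₀ hq₁ (2 ^ (a + k))
    have hpos : 0 < 2 ^ (a + k) := by positivity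
    have h2 : 2 ^ (a + k + 1) = 2 ^ (a + k) + 2 ^ (a + k) := by ring
    rw [← Nat.add_assoc a k 1, h2, show 2 ^ (a + k) + 2 ^ (a + k) - 1 =
      2 ^ (a + k) + (2 ^ (a + k) - 1) by omega, pow_add (1 - p), pow_add (1 - p), pow_succ]
    push_cast at h
    have := mul_le_mul_of_nonneg_left h (pow_nonneg hq₀ (2 ^ (a + k)))
    linarith
  have hpow : (1 - p) ^ 2 ^ (a + 0) ≤ 1 := pow_le_one₀ hq₀ hq₁
  have hpow' : 0 ≤ (1 - p) ^ 2 ^ (a + K) := pow_nonneg hq₀ _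
  calc _ ≤ ∑ k ∈ Finset.range K,
        2 * ((1 - p) ^ 2 ^ (a + k) - (1 - p) ^ 2 ^ (a + (k + 1))) :=
        Finset.sum_le_sum fun k _ => key k
    _ = 2 * ((1 - p) ^ 2 ^ (a + 0) - (1 - p) ^ 2 ^ (a + K)) := by
        rw [← Finset.mul_sum, Finset.sum_range_sub' fun k => (1 - p) ^ 2 ^ (a + k)]
    _ ≤ 2 := by linarith

/-- The probability that a lone device transmits in slot `k`. -/
noncomputable def Algorithm.rate (A : Algorithm M Out) (model : CDModel) (d k : ℕ) : ℝ :=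
  (expect (A.solo model d) fun h => ind (TransmitsAt h k)).toReal

theorem Algorithm.rate_nonneg (A : Algorithm M Out) (model : CDModel) (d k : ℕ) :
    0 ≤ A.rate model d k := ENNReal.toReal_nonneg

theorem Algorithm.rate_le_one (A : Algorithm M Out) (model : CDModel) (d k : ℕ) :
    A.rate model d k ≤ 1 :=
  ENNReal.toReal_le_of_le_ofReal zero_le_one (by simpa using expect_ind_le_one _ _)

/-- By independence a given device is the only transmitter with probability `p (1 - p) ^ (n - 1)`;
the factor `n` is a union bound. -/
theorem expect_singleAt_le (A : Algorithm M Out) (model : CDModel) (n d k : ℕ) :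
    expect (A.run model (mute (n := n)) d) (fun H => ind (SingleAt H k)) ≤
      ENNReal.ofReal (n * (A.rate model d k * (1 - A.rate model d k) ^ (n - 1))) := by
  classical
  set p := A.rate model d k with hp
  have hp₀ : 0 ≤ p := A.rate_nonneg model d k
  have hp₁ : p ≤ 1 := A.rate_le_one model d k
  have hT : (expect (A.solo model d) fun h => ind (TransmitsAt h k)) = ENNReal.ofReal p :=
    (ENNReal.ofReal_toReal (expect_ind_ne_top _ _)).symm
  have hN : (expect (A.solo model d) fun h => ind (¬ TransmitsAt h k)) = ENNReal.ofReal (1 - p) := by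
    rw [expect_ind_not, hT, ENNReal.ofReal_sub _ hp₀, ENNReal.ofReal_one]
  have h₁ : ∀ i : Fin n, (expect (A.run model (mute (n := n)) d) fun H =>
      ind (TransmitsAt (H i) k ∧ ∀ j, j ≠ i → ¬ TransmitsAt (H j) k)) =
        ENNReal.ofReal (p * (1 - p) ^ (n - 1)) := by
    intro i
    have := expect_run_mute_prod (A := A) (model := model) d fun (j : Fin n) h =>
      if j = i then ind (TransmitsAt h k) else ind (¬ TransmitsAt h k)
    rw [← Finset.mul_prod_erase _ _ (Finset.mem_univ i), Finset.prod_congr rfl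
      (g := fun _ => ENNReal.ofReal (1 - p))
      (fun j hj => by simp only [if_neg (Finset.ne_of_mem_erase hj)]; exact hN)] at this
    simp only [if_true, Finset.prod_const, Finset.card_erase_of_mem (Finset.mem_univ i),
      Finset.card_univ, Fintype.card_fin, hT] at this
    rw [ENNReal.ofReal_mul hp₀, ENNReal.ofReal_pow (sub_nonneg.2 hp₁), ← this]
    refine expect_congr fun H _ => ?_
    rw [← Finset.mul_prod_erase _ _ (Finset.mem_univ i), if_pos rfl, ind_and]
    congr 1
    by_cases h : ∀ j, j ≠ i → ¬ TransmitsAt (H j) k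
    · rw [ind_of_true h]
      refine (Finset.prod_eq_one fun j hj => ?_).symm
      have hj := Finset.ne_of_mem_erase hj
      rw [if_neg hj, ind_of_true (h j hj)]
    · rw [ind_of_false h]
      push Not at h
      obtain ⟨j, hj, hj'⟩ := h
      refine (Finset.prod_eq_zero (Finset.mem_erase.2 ⟨hj, Finset.mem_univ j⟩) ?_).symm
      rw [if_neg hj, ind_of_false (not_not.2 hj')]
  calc _ ≤ expect (A.run model (mute (n := n)) d) (fun H => ∑ i : Fin n,
          ind (TransmitsAt (H i) k ∧ ∀ j, j ≠ i → ¬ TransmitsAt (H j) k)) :=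
        expect_mono fun H => by
          refine le_trans (ind_mono ?_) (ind_exists_le Finset.univ _)
          rintro ⟨i, hi⟩
          exact ⟨i, Finset.mem_univ i, hi⟩
    _ = _ := by
        rw [expect_sum]
        simp only [h₁, Finset.sum_const, Finset.card_univ, Fintype.card_fin, nsmul_eq_mul]
        rw [ENNReal.ofReal_mul (Nat.cast_nonneg n), ENNReal.ofReal_natCast]

/-- Among `2 d²` consecutive scales there is a network size for which the first `d` slots are
likely to be quiet. -/
theorem exists_quiet_size (A : Algorithm M Out) (model : CDModel) {d : ℕ} (hd : 0 < d) (a : ℕ) :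
    ∃ k, a < k ∧ k ≤ a + 2 * d ^ 2 ∧
      expect (A.run model (mute (n := 2 ^ k)) d) (fun H => ind (¬ Quiet d H)) ≤
        ENNReal.ofReal (1 / d) := by
  let f (k j : ℕ) : ℝ := (2 : ℝ) ^ (a + k + 1) *
    (A.rate model d j * (1 - A.rate model d j) ^ (2 ^ (a + k + 1) - 1))
  have hd' : (0 : ℝ) < d := by exact_mod_cast hd
  -- Each of the `d` slots contributes at most 2 over all scales, and the total `2 d` is `1 / d` on
  -- average over `2 d²` scales.
  have hsum : ∑ k ∈ Finset.range (2 * d ^ 2), ∑ j ∈ Finset.range d, f k j ≤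
      ∑ k ∈ Finset.range (2 * d ^ 2), (1 / d : ℝ) := by
    rw [Finset.sum_comm]
    calc _ ≤ ∑ j ∈ Finset.range d, (2 : ℝ) := Finset.sum_le_sum fun j _ =>
          sum_two_pow_mul_le (A.rate_nonneg model d j) (A.rate_le_one model d j) a _
      _ = _ := by
          simp only [Finset.sum_const, Finset.card_range, nsmul_eq_mul]
          push_cast
          field_simp
  obtain ⟨k, hk, hle⟩ := Finset.exists_le_of_sum_le
    ⟨0, Finset.mem_range.2 (by positivity)⟩ hsum
  have hk := Finset.mem_range.1 hk
  refine ⟨a + k + 1, by omega, by omega, ?_⟩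
  calc _ ≤ expect (A.run model (mute (n := 2 ^ (a + k + 1))) d)
          (fun H => ∑ j ∈ Finset.range d, ind (SingleAt H j)) :=
        expect_mono fun H => by
          refine le_trans (ind_mono fun h => ?_) (ind_exists_le _ _)
          simpa [Quiet] using h
    _ ≤ ∑ j ∈ Finset.range d, ENNReal.ofReal (f k j) := by
        rw [expect_sum]
        refine Finset.sum_le_sum fun j _ => ?_
        have h := expect_singleAt_le A model (2 ^ (a + k + 1)) d j
        rwa [Nat.cast_pow, Nat.cast_ofNat] at h
    _ = ENNReal.ofReal (∑ j ∈ Finset.range d, f k j) :=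
        (ENNReal.ofReal_sum_of_nonneg fun j _ => by
          have h₀ := A.rate_nonneg model d j
          have h₁ := sub_nonneg.2 (A.rate_le_one model d j)
          positivity).symm
    _ ≤ _ := ENNReal.ofReal_le_ofReal hle

/-- The comparison covers only quiet executions, but both laws have total mass one, so it passes to
the complement. -/
theorem expect_run_not_quiet (hm : model = .senderCD ∨ model = .noCD) {d t : ℕ} (ht : d ≤ t) :
    expect (A.run model (channel (n := n)) t) (fun H => ind (¬ Quiet d H)) =
      expect (A.run model (mute (n := n)) d) (fun H => ind (¬ Quiet d H)) := by
  have h₁ := expect_run_take (A := A) (model := model) (c := channel (n := n)) ht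
    fun H => ind (¬ Quiet d H)
  simp only [quiet_take] at h₁
  have h₂ := expect_run_quiet (A := A) (n := n) hm d fun _ => 1
  simp only [one_mul] at h₂
  rw [h₁, expect_ind_not, expect_ind_not, h₂]

theorem expect_rests_and_quiet (hm : model = .senderCD ∨ model = .noCD) {d t : ℕ} (ht : d ≤ t)
    (s : Fin n) (X : History M → Prop) :
    expect (A.run model channel t) (fun H => ind ((X (H s) ∧ Rests d t (H s)) ∧ Quiet d H)) =
      expect (A.run model mute t) (fun H => ind ((X (H s) ∧ Rests d t (H s)) ∧ Quiet d H)) := by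
  simp only [ind_and]
  exact expect_run_rests hm ht s fun h => ind (X h)

theorem expect_rests_le_solo (hm : model = .senderCD ∨ model = .noCD) {d t : ℕ} (ht : d ≤ t)
    (s : Fin n) :
    expect (A.run model channel t) (fun H => ind (Rests d t (H s) ∧ Quiet d H)) ≤
      expect (A.solo model t) (fun h => ind (Rests d t h)) := by
  have := expect_rests_and_quiet (A := A) hm ht s fun _ => True
  simp only [true_and] at this
  rw [this, ← expect_run_mute_apply t s]
  exact expect_mono fun H => ind_mono And.left

/-- Under the mute rule device `s` is a lone device regardless of the others, so the transfer to the
real channel loses only the probability of a start that is not quiet. -/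
theorem solo_rests_le_expect (hm : model = .senderCD ∨ model = .noCD) {d t : ℕ} (ht : d ≤ t)
    (s : Fin n) (X : History M → Prop) :
    expect (A.solo model t) (fun h => ind (X h ∧ Rests d t h)) ≤
      expect (A.run model channel t) (fun H => ind ((X (H s) ∧ Rests d t (H s)) ∧ Quiet d H)) +
        expect (A.run model (mute (n := n)) d) (fun H => ind (¬ Quiet d H)) := by
  have h := expect_run_take (A := A) (model := model) (c := mute (n := n)) ht
    fun H => ind (¬ Quiet d H)
  simp only [quiet_take] at h
  rw [expect_rests_and_quiet hm ht s, ← h, ← expect_run_mute_apply t s]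
  exact expect_ind_le_add_not _ _ _

theorem solo_rests_eq {d t t' : ℕ} (ht : t ≤ t') :
    expect (A.solo model t') (fun h => ind (Rests d t h)) =
      expect (A.solo model t) (fun h => ind (Rests d t h)) := by
  -- A lone device is a mute network of size one.
  have := expect_run_take (A := A) (model := model) (c := mute (n := 1)) ht
    fun H => ind (Rests d t (H 0))
  simp only [rests_take] at this
  rwa [expect_run_mute_apply t' (0 : Fin 1) fun h => ind (Rests d t h),
    expect_run_mute_apply t (0 : Fin 1) fun h => ind (Rests d t h)] at this

/-- An interval which a lone device sees is idle with the same probability bound in a quiet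
network. -/
theorem expect_rests_early_le_solo (hm : model = .senderCD ∨ model = .noCD) {e e' d t : ℕ}
    (he : e' ≤ d) (ht : d ≤ t) (s : Fin n) :
    expect (A.run model channel t) (fun H => ind (Rests e e' (H s) ∧ Quiet d H)) ≤
      expect (A.solo model e') (fun h => ind (Rests e e' h)) := by
  have h := expect_run_take (A := A) (model := model) (c := channel (n := n)) ht
    fun H => ind (Rests e e' (H s) ∧ Quiet d H)
  simp only [quiet_take, rests_take_of_le he, ind_and] at h
  simp only [ind_and]
  rw [h, expect_run_quiet hm d fun H => ind (Rests e e' (H s)), ← solo_rests_eq he,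
    ← expect_run_mute_apply d s]
  simp only [← ind_and]
  exact expect_mono fun H => ind_mono And.left

end

/-! ### Solving a problem prevents a lone device from resting. -/

section

variable {M : Type u} {n : ℕ} {P : Problem} {A : Algorithm M P.Output} {model : CDModel}

theorem Problem.Solved.isSome {out : Fin n → Option P.Output} {H : Fin n → History M}
    (h : P.Solved out H) (i : Fin n) : (out i).isSome := by
  cases P with
  | approximateCounting κ hκ =>
    obtain ⟨est, -, -, h⟩ := h
    rw [h i]; rfl
  | leaderElection =>
    obtain ⟨ℓ, hℓ, h, -⟩ := h
    by_cases hi : i = ℓ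
    · rw [hi, hℓ]; rfl
    · rw [h i hi]; rfl
  | contentionResolution => rw [(h i).1]; rfl

theorem Algorithm.Success.step_eq {H : Fin n → History M} (h : A.Success H) (s : Signal M)
    (a : Fin n → Action M) : (fun i => A.step model s (H i) (a i)) = H := by
  ext1 i
  rw [Algorithm.step, if_pos (Problem.Solved.isSome h i)]

/-- All states of a successful profile are terminal and hence frozen, so success at time `T n`
persists. -/
theorem Algorithm.SolvesInTime.expect_le {T : ℕ → ℕ} (hA : A.SolvesInTime model T) (hn : 2 ≤ n)
    {t : ℕ} (ht : T n ≤ t) :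
    expect (A.run model (channel (n := n)) t) (fun H => ind (¬ A.Success H)) ≤
      ENNReal.ofReal (1 / n) := by
  have h := hA n hn
  rw [Algorithm.exec_eq_run, prob_eq_expect] at h
  have hn' : (0 : ℝ) < n := by exact_mod_cast (by omega : 0 < n)
  rw [ENNReal.ofReal_div_of_pos hn', ENNReal.ofReal_one, ENNReal.ofReal_natCast]
  refine le_trans ?_ h
  simp only [Set.mem_ofPred_eq, expect_ind_not]
  exact tsub_le_tsub_left (expect_run_mono (fun H s a hS => by rwa [hS.step_eq]) ht) 1

/-- In a network with a quiet start, a resting device can have only such states as are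
compatible with success. -/
theorem solo_rests_le_of_not_success {T : ℕ → ℕ} (hm : model = .senderCD ∨ model = .noCD)
    (hA : A.SolvesInTime model T) {d t : ℕ} (hd : 0 < d) (ht : d ≤ t) (hn : d + 1 ≤ n)
    (hT : T n ≤ t)
    (hq : expect (A.run model (mute (n := n)) d) (fun H => ind (¬ Quiet d H)) ≤
      ENNReal.ofReal (1 / d))
    (s : Fin n) (X : History M → Prop)
    (hX : ∀ H, A.Success H → Quiet d H → Rests d t (H s) → ¬ X (H s)) :
    expect (A.solo model t) (fun h => ind (X h ∧ Rests d t h)) ≤ ENNReal.ofReal (2 / d) := by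
  have hd' : (0 : ℝ) < d := by exact_mod_cast hd
  have hn' : (d : ℝ) ≤ n := by exact_mod_cast (by omega : d ≤ n)
  have h₁ : expect (A.run model channel t)
      (fun H => ind ((X (H s) ∧ Rests d t (H s)) ∧ Quiet d H)) ≤ ENNReal.ofReal (1 / d) := by
    refine le_trans (expect_mono fun H => ind_mono fun h => ?_)
      ((hA.expect_le (by omega) hT).trans
        (ENNReal.ofReal_le_ofReal (one_div_le_one_div_of_le hd' hn')))
    exact fun hs => hX H hs h.2 h.1.2 h.1.1
  calc _ ≤ ENNReal.ofReal (1 / d) + ENNReal.ofReal (1 / d) :=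
        (solo_rests_le_expect hm ht s X).trans (add_le_add h₁ hq)
    _ = ENNReal.ofReal (2 / d) := by
        rw [← ENNReal.ofReal_add (by positivity) (by positivity)]
        congr 1
        ring

/-- The length bound, which always holds, is the property `X` used for leader election and
contention resolution: it places the slot in which energy must be spent before `t`. -/
theorem solo_rests_eq_length (d t : ℕ) :
    expect (A.solo model t) (fun h => ind (Rests d t h)) =
      expect (A.solo model t) (fun h => ind (h.length ≤ t ∧ Rests d t h)) := by
  have h := fun f => expect_run_mute_apply (A := A) (model := model) t (0 : Fin 1) f
  rw [← h, ← h]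
  refine expect_congr fun H hH => ind_congr ?_
  exact (and_iff_right (aligned_of_mem_support hH 0).1).symm

theorem scale_bound {d : ℕ} (hd : 4 ≤ d) : 2 * d + 4 * d ^ 2 ≤ 2 ^ 2 ^ 2 ^ d := by
  have h₁ : d ^ 2 ≤ 2 ^ d := by
    induction d, hd using Nat.le_induction with
    | base => norm_num
    | succ d hd ih => rw [pow_succ 2 d]; nlinarith
  have h₂ : d < 2 ^ d := Nat.lt_two_pow_self
  have h₃ : (2 ^ d) ^ 2 ≤ 2 ^ 2 ^ d := by
    rw [← pow_mul]
    exact Nat.pow_le_pow_right (by norm_num) (by nlinarith)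
  have h₄ : 2 ^ 2 ^ d < 2 ^ 2 ^ 2 ^ d := Nat.lt_two_pow_self
  have h₅ : 16 ≤ 2 ^ d := by nlinarith
  nlinarith

/-- The gap `L` separates the two sizes for approximate counting; the other problems need only `k`.
The bound on `k'` accounts for three of the four exponentials in `checkpoint`, the fourth coming
from the size `2 ^ k'`. -/
theorem exists_quiet_size_le (A : Algorithm M P.Output) (model : CDModel) {d L : ℕ} (hd : 4 ≤ d)
    (hL : L ≤ d) : ∃ k k', d < k ∧ k + L < k' ∧ k' ≤ 2 ^ 2 ^ 2 ^ d ∧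
      expect (A.run model (mute (n := 2 ^ k)) d) (fun H => ind (¬ Quiet d H)) ≤
        ENNReal.ofReal (1 / d) ∧
      expect (A.run model (mute (n := 2 ^ k')) d) (fun H => ind (¬ Quiet d H)) ≤
        ENNReal.ofReal (1 / d) := by
  obtain ⟨k, hk, hk', hq⟩ := exists_quiet_size A model (by omega : 0 < d) d
  obtain ⟨l, hl, hl', hq'⟩ := exists_quiet_size A model (by omega : 0 < d) (d + 2 * d ^ 2 + L)
  have := scale_bound hd
  exact ⟨k, l, hk, by omega, by omega, hq, hq'⟩

theorem succ_le_two_pow {d k : ℕ} (h : d < k) : d + 1 ≤ 2 ^ k :=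
  h.trans_le Nat.lt_two_pow_self.le

/-- A lone device is unlikely to rest between two checkpoints. -/
theorem exists_solo_rests_le (P : Problem) : ∃ D : ℕ, ∀ (M : Type u) (model : CDModel),
    (model = .senderCD ∨ model = .noCD) → ∀ (A : Algorithm M P.Output) (T : ℕ → ℕ),
      Monotone T → A.SolvesInTime model T → ∀ d t : ℕ, D ≤ d → d ≤ t →
        T (2 ^ 2 ^ 2 ^ 2 ^ d) ≤ t →
        expect (A.solo model t) (fun h => ind (Rests d t h)) ≤ ENNReal.ofReal (4 / d) := by
  have pow_le : ∀ {k m : ℕ}, k ≤ m → 2 ^ k ≤ 2 ^ m := Nat.pow_le_pow_right (by norm_num)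
  have two_le : ∀ d : ℕ, ENNReal.ofReal (2 / d) ≤ ENNReal.ofReal (4 / d) := fun d =>
    ENNReal.ofReal_le_ofReal (by gcongr; norm_num)
  cases P with
  | approximateCounting κ hκ =>
    obtain ⟨L, hL⟩ := pow_unbounded_of_one_lt (κ * κ) (one_lt_two : (1 : ℝ) < 2)
    refine ⟨max 4 L, fun M model hm A T hT hA d t hd hdt ht => ?_⟩
    obtain ⟨k, k', hk, hk', hle, hq, hq'⟩ := exists_quiet_size_le A model (le_of_max_le_left hd)
      (le_of_max_le_right hd)
    have hd₀ : 0 < d := by have := le_of_max_le_left hd; omega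
    let good (n : ℕ) (h : History M) : Prop :=
      ∃ est : ℝ, (n : ℝ) / κ ≤ est ∧ est ≤ κ * n ∧ A.output h = some est
    have hgood : ∀ n (s : Fin n) (H : Fin n → History M), A.Success H → ¬ ¬ good n (H s) := by
      rintro n s H ⟨est, h₁, h₂, h₃⟩
      exact not_not.2 ⟨est, h₁, h₂, h₃ s⟩
    -- The sizes differ by a factor of at least `2 ^ L > κ²`, so no estimate suits both.
    have hdisj : ∀ h, ¬ good (2 ^ k) h ∨ ¬ good (2 ^ k') h := by
      intro h
      by_contra! hc
      obtain ⟨⟨x, -, hx, hxo⟩, ⟨y, hy, -, hyo⟩⟩ := hc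
      have hxy : x = y := Option.some.inj (hxo.symm.trans hyo)
      subst hxy
      have hκ₀ : 0 < κ := by linarith
      push_cast at hx hy
      rw [div_le_iff₀ hκ₀] at hy
      have h₁ : (2 : ℝ) ^ (k + L) ≤ 2 ^ k' := pow_le_pow_right₀ one_le_two hk'.le
      rw [pow_add] at h₁
      have h₂ : (0 : ℝ) < 2 ^ k := by positivity
      have h₃ := mul_le_mul_of_nonneg_right hx hκ₀.le
      have h₄ := mul_lt_mul_of_pos_left hL h₂
      linarith
    have key : ∀ l, d < l → l ≤ 2 ^ 2 ^ 2 ^ d →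
        expect (A.run model (mute (n := 2 ^ l)) d) (fun H => ind (¬ Quiet d H)) ≤
          ENNReal.ofReal (1 / d) →
        expect (A.solo model t) (fun h => ind (¬ good (2 ^ l) h ∧ Rests d t h)) ≤
          ENNReal.ofReal (2 / d) := fun l hl hl' hq =>
      solo_rests_le_of_not_success hm hA hd₀ hdt (succ_le_two_pow hl)
        ((hT (pow_le hl')).trans ht) hq ⟨0, by positivity⟩ _ fun H hs _ _ => hgood _ _ H hs
    calc _ ≤ expect (A.solo model t) (fun h => ind (¬ good (2 ^ k) h ∧ Rests d t h)) +
          expect (A.solo model t) (fun h => ind (¬ good (2 ^ k') h ∧ Rests d t h)) := by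
          rw [← expect_add]
          refine expect_mono fun h => le_trans (ind_mono fun hr => ?_) ind_or_le
          exact (hdisj h).imp (fun h => ⟨h, hr⟩) fun h => ⟨h, hr⟩
      _ ≤ ENNReal.ofReal (2 / d) + ENNReal.ofReal (2 / d) :=
          add_le_add (key k hk (by omega) hq) (key k' (by omega) hle hq')
      _ = _ := by
          rw [← ENNReal.ofReal_add (by positivity) (by positivity)]
          congr 1
          ring
  | leaderElection =>
    refine ⟨4, fun M model hm A T hT hA d t hd hdt ht => ?_⟩
    obtain ⟨k, k', hk, hk', hle, hq, -⟩ := exists_quiet_size_le A model hd (Nat.zero_le d)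
    have := solo_rests_le_of_not_success hm hA (by omega) hdt (succ_le_two_pow hk)
      ((hT (pow_le (by omega))).trans ht) (X := fun h => h.length ≤ t) hq ⟨0, by positivity⟩ ?_
    · exact (solo_rests_eq_length d t).trans_le (this.trans (two_le d))
    · rintro H ⟨ℓ, -, -, e, hlen, hℓ, hf⟩ hquiet hrests hlt
      rw [hlen] at hlt
      -- The final slot `e` has a single transmitter, so a quiet start excludes `e < d`; from `d` on
      -- it contradicts rest, as every device pays in it.
      by_cases he : e < d
      · refine hquiet e he ⟨ℓ, hℓ, ?_⟩
        rintro j hj ⟨m, σ, hm⟩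
        obtain ⟨σ', hσ'⟩ := hf j hj
        rw [hm] at hσ'
        simp at hσ'
      · refine hrests e (by omega) (by omega) ?_
        by_cases hs : (⟨0, by positivity⟩ : Fin (2 ^ k)) = ℓ
        · obtain ⟨m, σ, hmσ⟩ := hℓ
          exact ⟨(.transmit m, σ), by rw [hs]; exact hmσ, trivial⟩
        · obtain ⟨σ, hσ⟩ := hf _ hs
          exact ⟨_, hσ, trivial⟩
  | contentionResolution =>
    refine ⟨4, fun M model hm A T hT hA d t hd hdt ht => ?_⟩
    obtain ⟨k, k', hk, hk', hle, hq, -⟩ := exists_quiet_size_le A model hd (Nat.zero_le d)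
    have := solo_rests_le_of_not_success hm hA (by omega) hdt (succ_le_two_pow hk)
      ((hT (pow_le (by omega))).trans ht) (X := fun h => h.length ≤ t) hq ⟨0, by positivity⟩ ?_
    · exact (solo_rests_eq_length d t).trans_le (this.trans (two_le d))
    · intro H hsuc hquiet hrests hlt
      obtain ⟨-, e, ⟨m, σ, hmσ⟩, hother⟩ := hsuc ⟨0, by positivity⟩
      by_cases he : e < d
      · exact hquiet e he ⟨_, ⟨m, σ, hmσ⟩, hother⟩
      · have : e < (H ⟨0, by positivity⟩).length := (List.getElem?_eq_some_iff.1 hmσ).1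
        exact hrests e (by omega) (by omega) ⟨_, hmσ, trivial⟩

/-! ### Growth of the checkpoints and the detailed form of the bound. -/

section Checkpoint

variable {T : ℕ → ℕ} {d₁ : ℕ}

/-- Doubling is all that is needed: it makes the reciprocals of the checkpoints summable with a
geometric bound. -/
theorem two_mul_checkpoint_le (hT : ∀ n, n ≤ T n) (j : ℕ) :
    2 * checkpoint T d₁ j ≤ checkpoint T d₁ (j + 1) := by
  refine le_trans ?_ (hT _)
  generalize checkpoint T d₁ j = d
  have h₁ : d < 2 ^ d := Nat.lt_two_pow_self
  calc 2 * d ≤ 2 ^ (d + 1) := by rw [pow_succ]; omega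
    _ ≤ 2 ^ 2 ^ d := Nat.pow_le_pow_right (by norm_num) h₁
    _ ≤ 2 ^ 2 ^ 2 ^ d := Nat.lt_two_pow_self.le
    _ ≤ _ := Nat.lt_two_pow_self.le

theorem two_pow_mul_le_checkpoint (hT : ∀ n, n ≤ T n) (j : ℕ) :
    2 ^ j * d₁ ≤ checkpoint T d₁ j := by
  induction j with
  | zero => simp [checkpoint]
  | succ j ih =>
    refine le_trans ?_ (two_mul_checkpoint_le hT j)
    rw [pow_succ]
    linarith

theorem monotone_checkpoint (hT : ∀ n, n ≤ T n) : Monotone (checkpoint T d₁) :=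
  monotone_nat_of_le_succ fun j => by
    have := two_mul_checkpoint_le (d₁ := d₁) hT j
    omega

theorem le_checkpoint (hT : ∀ n, n ≤ T n) (j : ℕ) : d₁ ≤ checkpoint T d₁ j :=
  monotone_checkpoint hT (Nat.zero_le j)

theorem sum_inv_checkpoint_le (hT : ∀ n, n ≤ T n) (hd : 0 < d₁) (i : ℕ) :
    ∑ j ∈ Finset.range i, (1 : ℝ) / checkpoint T d₁ j ≤ 2 / d₁ := by
  have hd' : (0 : ℝ) < d₁ := by exact_mod_cast hd
  calc _ ≤ ∑ j ∈ Finset.range i, (1 / 2 : ℝ) ^ j * (1 / d₁) := by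
        refine Finset.sum_le_sum fun j _ => ?_
        rw [one_div_pow, one_div_mul_one_div]
        refine one_div_le_one_div_of_le (by positivity) ?_
        exact_mod_cast two_pow_mul_le_checkpoint hT j
    _ ≤ 2 * (1 / d₁) := by
        rw [← Finset.sum_mul]
        gcongr
        exact sum_geometric_two_le i
    _ = _ := by ring

end Checkpoint

/-- Between any two consecutive checkpoints, devices are likely to spend energy. -/
theorem exists_size_spending (P : Problem) : ∃ D : ℕ, ∀ (M : Type u) (model : CDModel),
    (model = .senderCD ∨ model = .noCD) →
      ∀ (A : Algorithm M P.Output) (T : ℕ → ℕ), Monotone T → (∀ n, n ≤ T n) →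
        A.SolvesInTime model T →
        ∀ d₁ : ℕ, D ≤ d₁ → ∀ i : ℕ, ∃ n : ℕ,
          checkpoint T d₁ i + 1 ≤ n ∧ n ≤ checkpoint T d₁ (i + 1) ∧
          ∀ s : Fin n,
            1 / 2 ≤ prob (A.exec model n (checkpoint T d₁ (i + 1)))
              {H | ∀ j ≤ i, ∃ k, checkpoint T d₁ j ≤ k ∧ k < checkpoint T d₁ (j + 1) ∧
                SpendsAt (H s) k} := by
  obtain ⟨D, hD⟩ := exists_solo_rests_le P
  -- The failure probability is at most `4 * (2 / d₁) + 1 / d₁ = 9 / d₁`, which is at most `1 / 2`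
  -- for `d₁ ≥ 18`.
  refine ⟨max D 18, fun M model hm A T hT hTn hA d₁ hd₁ i => ?_⟩
  have hd₁D := le_of_max_le_left hd₁
  have hd₁18 := le_of_max_le_right hd₁
  set d := checkpoint T d₁ with hd
  have hmono : Monotone d := monotone_checkpoint hTn
  have hle : ∀ j, d₁ ≤ d j := le_checkpoint hTn
  obtain ⟨k, k', hk, hk', hk'', hq, -⟩ := exists_quiet_size_le A model
    (by have := hle i; omega : 4 ≤ d i) (Nat.zero_le _)
  have hsolo : ∀ j, expect (A.solo model (d (j + 1))) (fun h => ind (Rests (d j) (d (j + 1)) h)) ≤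
      ENNReal.ofReal (4 / d j) := fun j =>
    hD M model hm A T hT hA _ _ (hd₁D.trans (hle j)) (hmono j.le_succ) le_rfl
  have hsize : 2 ^ k ≤ d (i + 1) :=
    (Nat.pow_le_pow_right (by norm_num) (by omega)).trans (hTn (2 ^ 2 ^ 2 ^ 2 ^ d i))
  refine ⟨2 ^ k, succ_le_two_pow hk, hsize, fun s => ?_⟩
  rw [Algorithm.exec_eq_run, prob_eq_expect]
  set R := A.run model (channel (n := 2 ^ k)) (d (i + 1))
  have hrest : ∀ j ∈ Finset.range (i + 1),
      expect R (fun H => ind (Rests (d j) (d (j + 1)) (H s) ∧ Quiet (d i) H)) ≤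
        ENNReal.ofReal (4 / d j) := by
    intro j hj
    -- Intervals with `j < i` lie inside the quiet start; the interval `j = i` comes after it and
    -- needs the comparison for resting devices.
    rcases Nat.lt_succ_iff_lt_or_eq.1 (Finset.mem_range.1 hj) with hj | rfl
    · exact (expect_rests_early_le_solo hm (hmono hj) (hmono i.le_succ) s).trans (hsolo j)
    · exact (expect_rests_le_solo hm (hmono j.le_succ) s).trans (hsolo j)
  have hfail : expect R (fun H => ind (¬ ∀ j ≤ i, ∃ k, d j ≤ k ∧ k < d (j + 1) ∧
      SpendsAt (H s) k)) ≤ 1 / 2 := by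
    calc _ ≤ expect R (fun H => ∑ j ∈ Finset.range (i + 1),
            ind (Rests (d j) (d (j + 1)) (H s) ∧ Quiet (d i) H)) +
          expect R (fun H => ind (¬ Quiet (d i) H)) := by
          refine (expect_ind_le_add_not _ _ (Quiet (d i))).trans ?_
          gcongr
          refine expect_mono fun H => le_trans (ind_mono ?_) (ind_exists_le _ _)
          rintro ⟨h, hqu⟩
          push Not at h
          obtain ⟨j, hj, h⟩ := h
          exact ⟨j, Finset.mem_range.2 (by omega), h, hqu⟩
      _ ≤ ∑ j ∈ Finset.range (i + 1), ENNReal.ofReal (4 / d j) + ENNReal.ofReal (1 / d i) := by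
          rw [expect_sum, expect_run_not_quiet hm (hmono i.le_succ)]
          exact add_le_add (Finset.sum_le_sum hrest) hq
      _ = ENNReal.ofReal (∑ j ∈ Finset.range (i + 1), 4 / (d j : ℝ) + 1 / d i) := by
          rw [ENNReal.ofReal_add (by positivity) (by positivity),
            ENNReal.ofReal_sum_of_nonneg fun j _ => by positivity]
      _ ≤ ENNReal.ofReal (1 / 2) := by
          refine ENNReal.ofReal_le_ofReal ?_
          have h₁ := sum_inv_checkpoint_le (d₁ := d₁) hTn (by omega) (i + 1)
          have h₂ : ∑ j ∈ Finset.range (i + 1), 4 / (d j : ℝ) =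
              4 * ∑ j ∈ Finset.range (i + 1), 1 / (d j : ℝ) := by
            rw [Finset.mul_sum]
            exact Finset.sum_congr rfl fun j _ => by ring
          have h18 : (18 : ℝ) ≤ d₁ := by exact_mod_cast hd₁18
          have h₃ : (1 : ℝ) / d i ≤ 1 / d₁ :=
            one_div_le_one_div_of_le (by linarith) (by exact_mod_cast hle i)
          have h₄ : (1 : ℝ) / d₁ ≤ 1 / 18 := one_div_le_one_div_of_le (by norm_num) h18
          have h₅ : (2 : ℝ) / d₁ = 2 * (1 / d₁) := by ring
          rw [h₂]
          linarith
      _ = 1 / 2 := by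
          rw [ENNReal.ofReal_div_of_pos (by norm_num)]; simp
  have htot := expect_ind_add_expect_ind_not R fun H => ∀ j ≤ i, ∃ k, d j ≤ k ∧ k < d (j + 1) ∧
    SpendsAt (H s) k
  by_contra! hlt
  have : (1 : ℝ≥0∞) < 1 := by
    calc (1 : ℝ≥0∞) = _ := htot.symm
      _ < 1 / 2 + 1 / 2 := ENNReal.add_lt_add_of_lt_of_le (expect_ind_ne_top _ _) hlt hfail
      _ = 1 := ENNReal.add_halves 1
  exact lt_irrefl _ this

end

/-! ### Towers and the iterated logarithm. -/

section Tower

theorem tower_succ (α x : ℕ) : tower (α + 1) x = 2 ^ tower α x := by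
  rw [tower, Function.iterate_succ_apply']; rfl

theorem tower_add (α β x : ℕ) : tower (α + β) x = tower α (tower β x) :=
  Function.iterate_add_apply _ α β x

theorem tower_mono_right (α : ℕ) : Monotone (tower α) :=
  Monotone.iterate (fun _ _ h => Nat.pow_le_pow_right (by norm_num) h) α

theorem le_tower (α x : ℕ) : x ≤ tower α x := by
  induction α with
  | zero => exact le_rfl
  | succ α ih => rw [tower_succ]; exact ih.trans Nat.lt_two_pow_self.le

theorem tower_mono_left (x : ℕ) : Monotone fun α => tower α x :=
  monotone_nat_of_le_succ fun α => by
    rw [tower_succ]; exact Nat.lt_two_pow_self.le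

theorem le_tower_one (d : ℕ) : d ≤ tower d 1 := by
  induction d with
  | zero => exact Nat.zero_le _
  | succ d ih => rw [tower_succ]; exact ih.trans_lt Nat.lt_two_pow_self

/-- One cannot simply take `j = k`: `Real.logb` ignores the sign of its argument, so iterates may
rise above 1 again, as in `1/8 ↦ -3 ↦ log₂ 3`. -/
theorem exists_iterate_logb_le_one {k : ℕ} {x : ℝ} (h : x ≤ tower k 1) :
    ∃ j ≤ k, (Real.logb 2)^[j] x ≤ 1 := by
  induction k generalizing x with
  | zero => exact ⟨0, le_rfl, by simpa [tower] using h⟩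
  | succ k ih =>
    by_cases hx : x ≤ 1
    · exact ⟨0, Nat.zero_le _, hx⟩
    · have hx₀ : 0 < x := by linarith
      rw [tower_succ] at h
      push_cast at h
      obtain ⟨j, hj, hle⟩ := ih (x := Real.logb 2 x) (by
        rw [Real.logb_le_iff_le_rpow one_lt_two hx₀]
        exact_mod_cast h)
      exact ⟨j + 1, by omega, hle⟩

theorem le_tower_of_iterate_logb_le_one {k : ℕ} {x : ℝ} (h : (Real.logb 2)^[k] x ≤ 1) :
    x ≤ tower k 1 := by
  induction k generalizing x with
  | zero => simpa [tower] using h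
  | succ k ih =>
    by_cases hx : x ≤ 0
    · exact hx.trans (Nat.cast_nonneg _)
    · have h := ih h
      rw [Real.logb_le_iff_le_rpow one_lt_two (not_le.1 hx)] at h
      rw [tower_succ]
      push_cast
      exact_mod_cast h

theorem logStar_le_iff {k : ℕ} {x : ℝ} : logStar x ≤ k ↔ x ≤ tower k 1 := by
  constructor
  · intro h
    -- The set defining `logStar` must be shown nonempty, since otherwise `sInf` would have the
    -- default value 0.
    obtain ⟨m, hm⟩ := exists_nat_ge x
    obtain ⟨j, -, hj⟩ := exists_iterate_logb_le_one
      (hm.trans (Nat.cast_le.2 (le_tower_one m)))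
    have hmem : (Real.logb 2)^[logStar x] x ≤ 1 :=
      Nat.sInf_mem (s := {k : ℕ | (Real.logb 2)^[k] x ≤ 1}) ⟨j, hj⟩
    exact (le_tower_of_iterate_logb_le_one hmem).trans (Nat.cast_le.2 (tower_mono_left 1 h))
  · intro h
    obtain ⟨j, hj, hle⟩ := exists_iterate_logb_le_one h
    exact (Nat.sInf_le hle).trans hj

end Tower

/-! ### From spending in many intervals to energy bounds. -/

section Energy

variable {M : Type u} {n : ℕ} {P : Problem} {A : Algorithm M P.Output} {model : CDModel}

theorem energy_append (h h' : History M) : energy (h ++ h') = energy h + energy h' := by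
  classical
  exact List.countP_append

theorem energy_le_step {Out : Type} (A : Algorithm M Out) (s : Signal M) (h : History M)
    (a : Action M) : energy h ≤ energy (A.step model s h a) := by
  unfold Algorithm.step
  split_ifs
  · exact le_rfl
  · rw [energy_append]; exact Nat.le_add_right _ _

theorem energy_take_lt {h : History M} {a b k : ℕ} (ha : a ≤ k) (hb : k < b)
    (hk : SpendsAt h k) : energy (h.take a) < energy (h.take b) := by
  obtain ⟨e, he, hc⟩ := hk
  have h₁ : h.take b = h.take a ++ (h.take b).drop a := by
    conv_lhs => rw [← List.take_append_drop a (h.take b), List.take_take, min_eq_left (by omega)]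
  rw [h₁, energy_append]
  have : 0 < energy ((h.take b).drop a) := by
    refine List.countP_pos_iff.2 ⟨e, ?_, by simpa using hc⟩
    refine List.mem_of_getElem? (i := k - a) ?_
    rw [List.getElem?_drop, List.getElem?_take, if_pos (by omega), ← he]
    congr 1
    omega
  omega

/-- The intervals are consecutive, so the energy of the prefix of length `d j` grows by at least one
with each `j`. -/
theorem lt_energy_of_spendsAt {h : History M} {d : ℕ → ℕ} {i : ℕ}
    (hs : ∀ j ≤ i, ∃ k, d j ≤ k ∧ k < d (j + 1) ∧ SpendsAt h k) : i < energy h := by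
  have key : ∀ j ≤ i + 1, j ≤ energy (h.take (d j)) := by
    intro j
    induction j with
    | zero => exact fun _ => Nat.zero_le _
    | succ j ih =>
      intro hj
      obtain ⟨k, hk, hk', hsp⟩ := hs j (by omega)
      exact (ih (by omega)).trans_lt (energy_take_lt hk hk' hsp)
  have h₁ := key (i + 1) le_rfl
  have h₂ : energy h = energy (h.take (d (i + 1))) + energy (h.drop (d (i + 1))) := by
    rw [← energy_append, List.take_append_drop]
  omega

/-- An energy bound is larger than a number of units which a device is likely to spend. -/
theorem Algorithm.SolvesInTimeEnergy.lt_energy {T E : ℕ → ℕ} (hA : A.SolvesInTimeEnergy model T E)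
    (hn : 3 ≤ n) {i t : ℕ} (s : Fin n)
    (hs : 1 / 2 ≤ prob (A.exec model n t) {H | i < energy (H s)}) : i < E n := by
  by_contra! hE
  have h₁ := hA n (by omega)
  rw [Algorithm.exec_eq_run, prob_eq_expect] at hs h₁
  simp only [Set.mem_ofPred_eq] at hs h₁
  -- Both events are irreversible, so they can be compared at a common time. If `E n ≤ i` they are
  -- incompatible, whence `1 / 2 ≤ 1 / n`, which fails for `n ≥ 3`.
  let t' := max t (T n)
  let R := A.run model (channel (n := n)) t'
  have hs' : 1 / 2 ≤ expect R fun H => ind (i < energy (H s)) :=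
    hs.trans (expect_run_mono (S := fun H => i < energy (H s))
      (fun H σ a h => h.trans_le (energy_le_step A σ (H s) (a s))) (le_max_left _ _))
  have h₁' : (expect R fun H => ind (¬ (A.Success H ∧ ∀ i, energy (H i) ≤ E n))) ≤ 1 / n := by
    refine le_trans ?_ h₁
    rw [expect_ind_not, expect_ind_not]
    exact tsub_le_tsub_left (expect_run_mono (fun H σ a h => by rwa [h.1.step_eq])
      (le_max_right _ _)) 1
  have h₂ : (1 / 2 : ℝ≥0∞) ≤ 1 / n := by
    refine hs'.trans (le_trans (expect_mono fun H => ind_mono fun h hc => ?_) h₁')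
    have := hc.2 s
    omega
  simp only [one_div, ENNReal.inv_le_inv] at h₂
  have : n ≤ 2 := by exact_mod_cast h₂
  omega

theorem Algorithm.SolvesInTimeEnergy.solvesInTime {T E T' : ℕ → ℕ}
    (hA : A.SolvesInTimeEnergy model T E) (hT : ∀ n, 1 ≤ n → T n ≤ T' n) :
    A.SolvesInTime model T' := by
  intro n hn
  have h := hA n hn
  rw [Algorithm.exec_eq_run, prob_eq_expect] at h ⊢
  simp only [Set.mem_ofPred_eq] at h ⊢
  refine le_trans ?_ h
  refine le_trans ?_ (expect_mono (f := fun H => ind (¬ A.Success H)) fun H =>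
    ind_mono fun hS hc => hS hc.1)
  rw [expect_ind_not, expect_ind_not]
  exact tsub_le_tsub_left (expect_run_mono (fun H σ a h => by rwa [h.step_eq])
    (hT n (by omega))) 1

end Energy

/-! ### The `log*` bounds. -/

theorem LogStarEnergyBound.mono {c : ℝ} {P : Problem} {F G : ℕ → ℕ}
    (h : LogStarEnergyBound.{u} c P G) (hFG : ∀ n, F n ≤ G n) : LogStarEnergyBound.{u} c P F := by
  obtain ⟨N₀, h⟩ := h
  exact ⟨N₀, fun M model hm A T E hT => h M model hm A T E fun n hn => (hT n hn).trans (hFG n)⟩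

/-- One checkpoint costs four exponentials by definition, `α` for the time bound, and one more to
absorb the factor `C + 1`, via `(C + 1) * y ≤ y ^ 2 ≤ 2 ^ y`. -/
theorem checkpoint_tower_le {α C d₁ : ℕ} (hC : C + 1 ≤ d₁) (hd : 4 ≤ d₁) (i : ℕ) :
    checkpoint (fun n => C * tower α n + n) d₁ i ≤ tower (i * (α + 5)) d₁ := by
  have hle : ∀ j, d₁ ≤ checkpoint (fun n => C * tower α n + n) d₁ j :=
    le_checkpoint fun n => Nat.le_add_left n _
  induction i with
  | zero => simp [checkpoint, tower]
  | succ i ih =>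
    have hle := hle i
    rw [checkpoint]
    generalize checkpoint (fun n => C * tower α n + n) d₁ i = d at ih hle
    have h4 : 2 ^ 2 ^ 2 ^ 2 ^ d = tower 4 d := rfl
    have hy : d ≤ tower (α + 4) d := le_tower _ _
    have hsq : ∀ y, 4 ≤ y → y ^ 2 ≤ 2 ^ y := by
      intro y hy
      induction y, hy using Nat.le_induction with
      | base => norm_num
      | succ y hy ih => rw [pow_succ 2 y]; nlinarith
    calc C * tower α (2 ^ 2 ^ 2 ^ 2 ^ d) + 2 ^ 2 ^ 2 ^ 2 ^ d
        ≤ C * tower (α + 4) d + tower (α + 4) d := by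
          rw [h4, tower_add]
          exact Nat.add_le_add_left (le_tower _ _) _
      _ = (C + 1) * tower (α + 4) d := by ring
      _ ≤ tower (α + 4) d ^ 2 := by
          rw [pow_two]
          exact Nat.mul_le_mul_right _ (by omega)
      _ ≤ 2 ^ tower (α + 4) d := hsq _ (by omega)
      _ = tower (α + 5) d := (tower_succ _ _).symm
      _ ≤ tower (α + 5) (tower (i * (α + 5)) d₁) := tower_mono_right _ ih
      _ = tower ((i + 1) * (α + 5)) d₁ := by rw [← tower_add]; congr 1; ring

theorem logStarEnergyBound_tower (α : ℕ) (P : Problem) (C : ℕ) :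
    LogStarEnergyBound.{u} (1 / (2 * (α + 5))) P fun n => C * tower α n := by
  obtain ⟨D, hD⟩ := exists_size_spending.{u} P
  let d₁ := max (max D (C + 1)) 4
  have hd₁D : D ≤ d₁ := (le_max_left _ _).trans (le_max_left _ _)
  have hd₁C : C + 1 ≤ d₁ := (le_max_right _ _).trans (le_max_left _ _)
  have hd₁4 : 4 ≤ d₁ := le_max_right _ _
  let b := α + 5
  -- For `m > m₀` the losses from the first checkpoint and from rounding in `q` cost at most a
  -- factor 2, whence `m ≤ 2 * b * q`.
  let m₀ := 2 * (d₁ + 1 + b)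
  refine ⟨tower m₀ 1 + 1, fun M model hm A T E hT hA N hN => ?_⟩
  -- `T` itself need not be monotone or at least the identity; this majorant is both.
  let T' : ℕ → ℕ := fun n => C * tower α n + n
  have hT'mono : Monotone T' := fun x y hxy =>
    Nat.add_le_add (Nat.mul_le_mul_left _ (tower_mono_right α hxy)) hxy
  have hT'le : ∀ n, n ≤ T' n := fun n => Nat.le_add_left n _
  have hA' : A.SolvesInTime model T' :=
    hA.solvesInTime fun n hn => (hT n hn).trans (Nat.le_add_right _ _)
  set m := logStar N with hm'
  have hm₀ : m₀ < m := by
    by_contra! h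
    have : N ≤ tower m₀ 1 := by exact_mod_cast logStar_le_iff.1 h
    omega
  have hmN : tower (m - 1) 1 ≤ N := by
    by_contra! h
    have : logStar N ≤ m - 1 := logStar_le_iff.2 (by exact_mod_cast h.le)
    omega
  have hb : 0 < b := by omega
  -- The largest number of checkpoints, at `b` exponentials each on top of `d₁ ≤ tower d₁ 1`, for
  -- which the tower height stays at most `m - 1`.
  let q := (m - 1 - d₁) / b
  have hq₁ : q * b ≤ m - 1 - d₁ := Nat.div_mul_le_self _ _
  have hq₂ : m - 1 - d₁ < (q + 1) * b := by
    rw [mul_comm]; exact Nat.lt_mul_div_succ _ hb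
  have hqb : m ≤ 2 * b * q := by
    have : (q + 1) * b = q * b + b := by ring
    have : 2 * b * q = 2 * (q * b) := by ring
    omega
  have hq₀ : q ≠ 0 := by
    intro h
    rw [h] at hqb
    omega
  obtain ⟨i, hi⟩ := Nat.exists_eq_succ_of_ne_zero hq₀
  obtain ⟨n, hn₁, hn₂, hn⟩ := hD M model hm A T' hT'mono hT'le hA' d₁ hd₁D i
  have hn3 : 3 ≤ n := by
    have := le_checkpoint (d₁ := d₁) hT'le i
    omega
  have hE : i < E n := by
    refine hA.lt_energy (t := checkpoint T' d₁ (i + 1)) hn3 ⟨0, by omega⟩ ((hn ⟨0, by omega⟩).trans ?_)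
    rw [prob_eq_expect, prob_eq_expect]
    exact expect_mono fun H => ind_mono fun h => lt_energy_of_spendsAt h
  refine ⟨n, by omega, ?_, ?_⟩
  · calc n ≤ tower ((i + 1) * b) d₁ := hn₂.trans (checkpoint_tower_le hd₁C hd₁4 _)
      _ ≤ tower ((i + 1) * b) (tower d₁ 1) := tower_mono_right _ (le_tower_one d₁)
      _ = tower (q * b + d₁) 1 := by rw [← tower_add, hi]
      _ ≤ tower (m - 1) 1 := tower_mono_left 1 (by omega)
      _ ≤ N := hmN
  · have hqE : (q : ℝ) ≤ E n := by exact_mod_cast (by omega : q ≤ E n)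
    have hqb' : (m : ℝ) ≤ 2 * (α + 5) * q := by exact_mod_cast hqb
    rw [one_div, inv_mul_le_iff₀ (by positivity)]
    exact hqb'.trans (by gcongr)

theorem exists_pow_le_mul_two_pow (k : ℕ) : ∃ K : ℕ, ∀ n : ℕ, n ^ k ≤ K * 2 ^ n := by
  obtain ⟨B, hB⟩ := (tendsto_pow_const_div_const_pow_of_one_lt k
    (one_lt_two : (1 : ℝ) < 2)).bddAbove_range
  obtain ⟨K, hK⟩ := exists_nat_ge B
  refine ⟨K, fun n => ?_⟩
  have h := (hB ⟨n, rfl⟩).trans hK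
  rw [div_le_iff₀ (by positivity)] at h
  exact_mod_cast h

end RadioNetwork

theorem mainTheorem1 :
    -- polynomial time
    (∃ c : ℝ, 0 < c ∧ ∀ (P : Problem) (k C : ℕ),
      LogStarEnergyBound.{u} c P fun n => C * n ^ k) ∧
    -- time bounded by a tower of exponentials of constant height
    (∀ α : ℕ, ∃ c : ℝ, 0 < c ∧ ∀ (P : Problem) (C : ℕ),
      LogStarEnergyBound.{u} c P fun n => C * tower α n) ∧
    -- arbitrary time bounds: one unit of energy between any two consecutive checkpoints
    (∀ P : Problem, ∃ D : ℕ, ∀ (M : Type u) (model : CDModel),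
      (model = .senderCD ∨ model = .noCD) →
      ∀ (A : Algorithm M P.Output) (T : ℕ → ℕ), Monotone T → (∀ n, n ≤ T n) →
        A.SolvesInTime model T →
        ∀ d₁ : ℕ, D ≤ d₁ → ∀ i : ℕ, ∃ n : ℕ,
          checkpoint T d₁ i + 1 ≤ n ∧ n ≤ checkpoint T d₁ (i + 1) ∧
          ∀ s : Fin n,
            1 / 2 ≤ prob (A.exec model n (checkpoint T d₁ (i + 1)))
              {H | ∀ j ≤ i, ∃ k, checkpoint T d₁ j ≤ k ∧ k < checkpoint T d₁ (j + 1) ∧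
                SpendsAt (H s) k}) := by
  refine ⟨⟨1 / (2 * ((1 : ℕ) + 5)), by positivity, fun P k C => ?_⟩,
    fun α => ⟨1 / (2 * (α + 5)), by positivity, fun P C => logStarEnergyBound_tower α P C⟩,
    exists_size_spending⟩
  -- A polynomial lies below a multiple of `tower 1 n`; the degree affects only the factor, so the
  -- constant `1 / 12` is absolute.
  obtain ⟨K, hK⟩ := exists_pow_le_mul_two_pow k
  refine (logStarEnergyBound_tower 1 P (C * K)).mono fun n => ?_
  rw [mul_assoc]
  exact Nat.mul_le_mul_left C (hK n)
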